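/- Let $N\ge 0$, $h>0$, and let $L:\mathbb T^N\times\mathbb R^N\to\mathbb R$ be continuous, with $L(x,\cdot)$ of class $C^2$ for every $x$, and such that (1) $L(x,v)/|v|\to+\infty$ as $|v|\to\infty$, uniformly in $x$; (2) the Hessian $\partial^2L/\partial v_i\partial v_j(x,v)$ is positive definite for all $(x,v)$; (3) there are constants $C,\Gamma>0$ with $L(x+y,v-z)+L(x-y,v+z)-2L(x,v)\le C|y|^2+\Gamma|z|^2$ for all $x\in\mathbb T^N$ and $y,v,z\in\mathbb R^N$. Let $\mathcal M_h$ be the set of Borel probability measures $\mu$ on $\mathbb T^N\times\mathbb R^N$ with $\int(\varphi(x+hv)-\varphi(x))\,d\mu=0$ for all $\varphi\in C(\mathbb T^N)$, and let $\overline H_h=\min_{\mu\in\mathcal M_h}\int L\,d\mu$; a minimizer is called a discrete Mather measure. A point $x\in\mathbb T^N$ belongs to the non-wandering set $\Omega_h(L)$ if for every $\delta>0$ there are $k\ge1$, $s\in\mathbb Z^N$ and points $x_0=x+s,x_1,\dots,x_k=x$ in $\mathbb R^N$ (with $x$ lifted to $\mathbb R^N$) such that $\bigl|h\sum_{i=0}^{k-1}\bigl(L(x_i,\tfrac{x_{i+1}-x_i}{h})-\overline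 H_h\bigr)\bigr|<\delta$. Suppose that $L$ is generic in the discrete sense: there is exactly one discrete Mather measure $\mu_h$, and $\pi_1(\operatorname{supp}\mu_h)=\Omega_h(L)$, where $\pi_1(x,v)=x$. Then: (a) There is a calibrated forward subaction, i.e. a continuous $u:\mathbb T^N\to\mathbb R$ with $u(x)=\inf_{v\in\mathbb R^N}\{u(x+hv)+hL(x,v)-h\overline H_h\}$ for all $x$, and it is unique up to an additive constant: the set of calibrated forward subactions is $\{u+c: c\in\mathbb R\}$. (b) Consequently the rate function $I_h$ is uniquely determined, in the following sense. For $\epsilon>0$ let $$\mathcal G_\epsilon[\phi](x)=-\epsilon h\ln\int_{\mathbb R^N}e^{-\frac{hL(x,v)+\phi(x+hv)}{\epsilon h}}dv,\qquad \bar{\mathcal G}_\epsilon[\phi](x)=-\epsilon h\ln\int_{\mathbb R^N}e^{-\frac{hL(x-hv,v)+\phi(x-hv)}{\epsilon h}}dv .$$ Call a pair of continuous functions $(\phi_\epsilon,\bar\phi_\epsilon)$ on $\mathbb T^N$ a normalized solution if $\mathcal G_\epsilon[\phi_\epsilon]=\phi_\epsilon+\lambda_\epsilon$ and $\bar{\mathcal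 G}_\epsilon[\bar\phi_\epsilon]=\bar\phi_\epsilon+\lambda_\epsilon$ for some $\lambda_\epsilon\in\mathbb R$, and $\int_{\mathbb T^N}e^{-(\bar\phi_\epsilon+\phi_\epsilon)/(\epsilon h)}dx=1$. Whenever normalized solutions converge uniformly, $\phi_{\epsilon_n}\to\phi_h$ and $\bar\phi_{\epsilon_n}\to\bar\phi_h$, along some sequence $\epsilon_n\to0^+$, the function $$I_h(x,v)=\frac{\bar\phi_h(x)+\phi_h(x+hv)}{h}+L(x,v)-\overline H_h$$ is the same, whatever the sequence $(\epsilon_n)$ and the solutions chosen. -/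

import Mathlib

open MeasureTheory Filter Topology

namespace DiscreteAubryMather

/-- Velocities (and points of the universal cover of the torus): `ℝᴺ` with the Euclidean norm. -/
abbrev Vel (N : ℕ) : Type := EuclideanSpace ℝ (Fin N)

/-- The torus `𝕋ᴺ = ℝᴺ / ℤᴺ`. -/
abbrev Torus (N : ℕ) : Type := UnitAddTorus (Fin N)

/-- The covering projection `ℝᴺ → 𝕋ᴺ`. -/
def toTorus {N : ℕ} (y : Vel N) : Torus N := fun i => ((y i : ℝ) : UnitAddCircle)

/-- An integer vector, seen as an element of `ℝᴺ`. -/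
def intVec {N : ℕ} (s : Fin N → ℤ) : Vel N := WithLp.toLp 2 (fun i => (s i : ℝ))

/-- The point `x + h v` of the torus. -/
def step {N : ℕ} (h : ℝ) (x : Torus N) (v : Vel N) : Torus N := x + toTorus (h • v)

/-- The point `x - h v` of the torus. -/
def backStep {N : ℕ} (h : ℝ) (x : Torus N) (v : Vel N) : Torus N := x - toTorus (h • v)

/-- Lagrangians on `𝕋ᴺ × ℝᴺ`: uniformly superlinear, with positive definite Hessian in `v`,
and jointly semiconcave in the quantitative sense of the last field. -/
structure IsLagrangian {N : ℕ} (L : Torus N → Vel N → ℝ) : Prop where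
  continuous : Continuous (fun q : Torus N × Vel N => L q.1 q.2)
  contDiff : ∀ x, ContDiff ℝ 2 (L x)
  superlinear : ∀ A : ℝ, ∃ R : ℝ, ∀ x v, R ≤ ‖v‖ → A * ‖v‖ ≤ L x v
  hessian_pos : ∀ x v w, w ≠ 0 → 0 < iteratedFDeriv ℝ 2 (L x) v ![w, w]
  semiconcave : ∃ C > (0 : ℝ), ∃ Γ > (0 : ℝ), ∀ (x : Torus N) (y v z : Vel N),
    L (x + toTorus y) (v - z) + L (x - toTorus y) (v + z) - 2 * L x v
      ≤ C * ‖y‖ ^ 2 + Γ * ‖z‖ ^ 2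

/-- Discrete holonomic probability measures, for the time step `h`. -/
structure IsHolonomic {N : ℕ} (h : ℝ) (μ : Measure (Torus N × Vel N)) : Prop where
  isProbabilityMeasure : IsProbabilityMeasure μ
  holonomic : ∀ φ : C(Torus N, ℝ), ∫ q, (φ (step h q.1 q.2) - φ q.1) ∂μ = 0

/-- The action `∫ L dμ`; used only for measures for which `L` is integrable. -/
noncomputable def action {N : ℕ} (L : Torus N → Vel N → ℝ) (μ : Measure (Torus N × Vel N)) : ℝ :=
  ∫ q, L q.1 q.2 ∂μ

/-- Holonomic measures of finite action (as `L` is bounded below, every other holonomic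
measure has action `+∞`). -/
def IsAdmissible {N : ℕ} (h : ℝ) (L : Torus N → Vel N → ℝ)
    (μ : Measure (Torus N × Vel N)) : Prop :=
  IsHolonomic h μ ∧ Integrable (fun q : Torus N × Vel N => L q.1 q.2) μ

/-- The critical value `H̄_h`, the minimal action of the holonomic measures. -/
noncomputable def criticalValue {N : ℕ} (h : ℝ) (L : Torus N → Vel N → ℝ) : ℝ :=
  sInf {a : ℝ | ∃ μ : Measure (Torus N × Vel N), IsAdmissible h L μ ∧ a = action L μ}

/-- Discrete Mather measures: the holonomic measures of minimal action. -/
def IsMather {N : ℕ} (h : ℝ) (L : Torus N → Vel N → ℝ) (μ : Measure (Torus N × Vel N)) : Prop :=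
  IsAdmissible h L μ ∧ ∀ ν, IsAdmissible h L ν → action L μ ≤ action L ν

/-- The action of `L - H̄_h` along the `k`-path `p 0, …, p k` in `ℝᴺ`. -/
noncomputable def pathAction {N : ℕ} (h : ℝ) (L : Torus N → Vel N → ℝ) (k : ℕ)
    (p : ℕ → Vel N) : ℝ :=
  h * ∑ i ∈ Finset.range k,
    (L (toTorus (p i)) (h⁻¹ • (p (i + 1) - p i)) - criticalValue h L)

/-- The set `Ω_h(L)` of non-wandering points; `y` is a representative of `x` in `ℝᴺ`. -/
def nonWandering {N : ℕ} (h : ℝ) (L : Torus N → Vel N → ℝ) : Set (Torus N) :=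
  {x | ∀ y : Vel N, toTorus y = x → ∀ ε > (0 : ℝ), ∃ k ≥ 1, ∃ s : Fin N → ℤ, ∃ p : ℕ → Vel N,
    p 0 = y + intVec s ∧ p k = y ∧ |pathAction h L k p| < ε}

/-- Discrete genericity: there is exactly one discrete Mather measure, and the projection of
its support to the torus is the non-wandering set. -/
def IsGeneric {N : ℕ} (h : ℝ) (L : Torus N → Vel N → ℝ) : Prop :=
  ∃ μ : Measure (Torus N × Vel N), {ν | IsMather h L ν} = {μ} ∧
    Prod.fst '' μ.support = nonWandering h L

/-- Calibrated forward subactions. -/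
structure IsCalibrated {N : ℕ} (h : ℝ) (L : Torus N → Vel N → ℝ) (u : Torus N → ℝ) : Prop where
  continuous : Continuous u
  calibrated : ∀ x, IsGLB
    (Set.range fun v : Vel N => u (step h x v) + h * L x v - h * criticalValue h L) (u x)

/-- The operator `𝒢` of the entropy penalized problem. -/
noncomputable def entropyOp {N : ℕ} (ε h : ℝ) (L : Torus N → Vel N → ℝ) (φ : Torus N → ℝ)
    (x : Torus N) : ℝ :=
  -(ε * h) * Real.log (∫ v : Vel N, Real.exp (-((h * L x v + φ (step h x v)) / (ε * h))))

/-- The backward operator `𝒢̄` of the entropy penalized problem. -/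
noncomputable def entropyOpBack {N : ℕ} (ε h : ℝ) (L : Torus N → Vel N → ℝ) (φ : Torus N → ℝ)
    (x : Torus N) : ℝ :=
  -(ε * h) * Real.log (∫ v : Vel N,
    Real.exp (-((h * L (backStep h x v) v + φ (backStep h x v)) / (ε * h))))

/-- Normalized solutions `φ_{ε,h}`, `φ̄_{ε,h}`, `λ_{ε,h}` of the two fixed point problems. -/
structure IsEntropySolution {N : ℕ} (ε h : ℝ) (L : Torus N → Vel N → ℝ)
    (φ φb : Torus N → ℝ) (lam : ℝ) : Prop where
  continuous : Continuous φ
  continuous_back : Continuous φb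
  fixed : ∀ x, entropyOp ε h L φ x = φ x + lam
  fixed_back : ∀ x, entropyOpBack ε h L φb x = φb x + lam
  normalized : ∫ x : Torus N, Real.exp (-((φb x + φ x) / (ε * h))) = 1

/-- `I` is a rate function `I_h`, built from uniform limits `φ_h`, `φ̄_h` of normalized solutions
`φ_{ε,h}`, `φ̄_{ε,h}` along some sequence `ε → 0`. -/
def IsRateFunction {N : ℕ} (h : ℝ) (L : Torus N → Vel N → ℝ) (I : Torus N → Vel N → ℝ) : Prop :=
  ∃ (ε : ℕ → ℝ) (φ φb : ℕ → Torus N → ℝ) (lam : ℕ → ℝ) (φ₀ φb₀ : Torus N → ℝ),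
    (∀ n, 0 < ε n) ∧ Tendsto ε atTop (𝓝 0) ∧
    (∀ n, IsEntropySolution (ε n) h L (φ n) (φb n) (lam n)) ∧
    TendstoUniformly φ φ₀ atTop ∧ TendstoUniformly φb φb₀ atTop ∧
    ∀ x v, I x v = (φb₀ x + φ₀ (step h x v)) / h + L x v - criticalValue h L

end DiscreteAubryMather

/-!
The velocities are eliminated by the one-step cost `cost h L x y`, the minimum of `h (L - H̄_h)`
over the lifts of the displacement from `x` to `y`. Superlinearity makes it a continuous function on a
compact space, and (forward, backward) calibrated subactions are the fixed points of the Lax–Oleinik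
operators of `cost h L` and of its reversal.

*Existence.* A loop carries a holonomic measure, so by the definition of the critical value all
loops have nonnegative cost (`Chain.nonneg`), and the non-wandering set becomes the Aubry set of the cost,
the points with loops of arbitrarily small cost (`nonWandering_eq_aubrySet`). It is nonempty by
genericity, and the Mañé potential to one of its points is a calibrated subaction
(`isWeakKAM_manePotential`).

*Uniqueness.* Two subactions `u`, `w` are both calibrated almost everywhere for the Mather measure
`μ`, so `w - u` is invariant under `(x, v) ↦ x + h v`. A positive affine function of `w - u`,
normalized, is then the density of another Mather measure; since there is only one, `w - u` is
constant on `π₁(supp μ)` (`IsMather.const_of_unique`), which is the Aubry set. Calibrated orbits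
accumulate in the Aubry set (`mem_aubrySet_of_tendsto`) and `w - u` is monotone along them, so a
constant difference there is a constant difference everywhere (`IsWeakKAM.eq_add_of_aubrySet`).
The same argument for the reversed cost, which has the same Aubry set, covers backward subactions.

*Rate function.* By Laplace's method (`tendsto_neg_mul_log_integral_exp`) the limits `φ_h`, `φ̄_h`
are fixed points of the two Lax–Oleinik operators up to an additive eigenvalue, which must be zero
(`IsWeakKAM.eigenvalue_eq_zero`). Hence each is determined up to a constant, and the normalization
forces `min (φ_h + φ̄_h) = 0` (`isLeast_zero_of_integral_exp_eq_one`), so the two constants cancel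
in the rate function.
-/

namespace DiscreteAubryMather

/-! ### Weak KAM theory of a continuous cost on a compact space -/

section Abstract

/-- `Chain c x y a`: some path with at least one step leads from `x` to `y` at total cost `a`. -/
inductive Chain {X : Type*} (c : X → X → ℝ) : X → X → ℝ → Prop
  | single (x y : X) : Chain c x y (c x y)
  | cons (x : X) {y z : X} {a : ℝ} : Chain c y z a → Chain c x z (c x y + a)

/-- The Aubry set of a cost: the points lying on loops of arbitrarily small cost. -/
def aubrySet {X : Type*} (c : X → X → ℝ) : Set X :=
  {z | ∀ ε > (0 : ℝ), ∃ a < ε, Chain c z z a}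

/-- Continuous fixed points of the Lax–Oleinik operator `u ↦ (x ↦ inf_y (c x y + u y))`. The fixed
points for the reversed cost `flip c` are the backward ones. -/
structure IsWeakKAM {X : Type*} [TopologicalSpace X] (c : X → X → ℝ) (u : X → ℝ) : Prop where
  continuous : Continuous u
  isGLB : ∀ x, IsGLB (Set.range fun y => c x y + u y) (u x)

/-- The Mañé potential: the infimal cost of the paths from `x` to `z`. -/
noncomputable def manePotential {X : Type*} (c : X → X → ℝ) (x z : X) : ℝ :=
  sInf {a | Chain c x z a}

variable {X : Type*} {c : X → X → ℝ}

lemma Chain.append {x y z : X} {a b : ℝ} (h₁ : Chain c x y a) (h₂ : Chain c y z b) :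
    Chain c x z (a + b) := by
  induction h₁ with
  | single x y => exact .cons x h₂
  | cons x _ ih => rw [add_assoc]; exact .cons x (ih h₂)

lemma Chain.flip {x y : X} {a : ℝ} (h₁ : Chain c x y a) : Chain (flip c) y x a := by
  induction h₁ with
  | single x y => exact .single (c := _root_.flip c) y x
  | @cons x y z a _ ih =>
    rw [add_comm]
    exact ih.append (.single (c := _root_.flip c) y x)

lemma aubrySet_flip : aubrySet (flip c) = aubrySet c := by
  ext z
  exact ⟨fun h ε hε => (h ε hε).imp fun _ ha => ⟨ha.1, ha.2.flip⟩,
    fun h ε hε => (h ε hε).imp fun _ ha => ⟨ha.1, ha.2.flip⟩⟩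

/-- Along a calibrated orbit the cost is the drop of the function. -/
lemma Chain.of_orbit {u : X → ℝ} {p : ℕ → X}
    (hp : ∀ i, c (p i) (p (i + 1)) + u (p (i + 1)) = u (p i))
    (m k : ℕ) : Chain c (p m) (p (m + k + 1)) (u (p m) - u (p (m + k + 1))) := by
  induction k generalizing m with
  | zero =>
    have := Chain.single (c := c) (p m) (p (m + 1))
    rwa [← eq_sub_of_add_eq (hp m)]
  | succ k ih =>
    have h₁ := Chain.cons (p m) (ih (m + 1))
    rw [show m + (k + 1) + 1 = m + 1 + k + 1 by ring]
    rwa [show u (p m) - u (p (m + 1 + k + 1))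
      = c (p m) (p (m + 1)) + (u (p (m + 1)) - u (p (m + 1 + k + 1))) by linarith [hp m]]

lemma bddBelow_chain (hc : ∀ x a, Chain c x x a → 0 ≤ a) (x z : X) :
    BddBelow {a | Chain c x z a} :=
  ⟨-c z x, fun a ha => by linarith [hc z _ (.cons z ha)]⟩

lemma manePotential_le (hc : ∀ x a, Chain c x x a → 0 ≤ a) (x y z : X) :
    manePotential c x z ≤ c x y + manePotential c y z := by
  rw [← sub_le_iff_le_add']
  refine le_csInf ⟨_, .single y z⟩ fun a ha => ?_
  rw [sub_le_iff_le_add']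
  exact csInf_le (bddBelow_chain hc x z) (.cons x ha)

lemma isGLB_manePotential (hc : ∀ x a, Chain c x x a → 0 ≤ a) {z : X} (hz : z ∈ aubrySet c)
    (x : X) : IsGLB (Set.range fun y => c x y + manePotential c y z) (manePotential c x z) := by
  refine ⟨?_, fun b hb => le_csInf ⟨_, .single x z⟩ fun a ha => ?_⟩
  · rintro _ ⟨y, rfl⟩
    exact manePotential_le hc x y z
  · have hzz : manePotential c z z ≤ 0 := le_of_forall_pos_lt_add fun ε hε => by
      obtain ⟨a, ha, h₁⟩ := hz ε hε
      linarith [csInf_le (bddBelow_chain hc z z) h₁, show manePotential c z z = sInf _ from rfl]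
    cases ha with
    | single => linarith [hb ⟨z, rfl⟩]
    | @cons _ y _ a h₁ =>
      linarith [hb ⟨y, rfl⟩, csInf_le (bddBelow_chain hc y z) h₁,
        show manePotential c y z = sInf _ from rfl]

lemma continuous_uncurry_flip [TopologicalSpace X] (hcc : Continuous (Function.uncurry c)) :
    Continuous (Function.uncurry (flip c)) :=
  hcc.comp continuous_swap

variable [PseudoMetricSpace X] [CompactSpace X]

/-- The infimum over `y` inherits the modulus of continuity of `c` in the first variable. -/
lemma continuous_of_isGLB (hcc : Continuous (Function.uncurry c)) {u : X → ℝ}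
    (hu : ∀ x, IsGLB (Set.range fun y => c x y + u y) (u x)) : Continuous u := by
  have huc := CompactSpace.uniformContinuous_of_continuous hcc
  rw [Metric.continuous_iff]
  intro x ε hε
  obtain ⟨δ, hδ, H⟩ := Metric.uniformContinuous_iff.1 huc (ε / 2) (half_pos hε)
  have key : ∀ x x', dist x x' < δ → u x ≤ u x' + ε / 2 := fun x x' hx => by
    rw [← sub_le_iff_le_add]
    refine (hu x').2 ?_
    rintro _ ⟨y, rfl⟩
    have h₁ : dist (c x y) (c x' y) < ε / 2 :=
      H (a := (x, y)) (b := (x', y)) (by simp [Prod.dist_eq, hx])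
    have h₂ := (hu x).1 ⟨y, rfl⟩
    rw [Real.dist_eq, abs_lt] at h₁
    simp only at h₂ ⊢
    linarith
  refine ⟨δ, hδ, fun x' hx' => ?_⟩
  rw [Real.dist_eq, abs_lt]
  constructor <;> linarith [key x' x hx', key x x' (by rwa [dist_comm])]

/-- For a base point in the Aubry set, the Mañé potential is a fixed point, not merely a
subsolution: a path that has just reached the base point can go round a loop at no cost. -/
lemma isWeakKAM_manePotential (hcc : Continuous (Function.uncurry c))
    (hc : ∀ x a, Chain c x x a → 0 ≤ a) {z : X} (hz : z ∈ aubrySet c) :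
    IsWeakKAM c (fun x => manePotential c x z) :=
  ⟨continuous_of_isGLB hcc (isGLB_manePotential hc hz), isGLB_manePotential hc hz⟩

lemma IsWeakKAM.exists_eq {u : X → ℝ} (hcc : Continuous (Function.uncurry c)) (hu : IsWeakKAM c u)
    (x : X) : ∃ y, c x y + u y = u x := by
  have hcont : Continuous fun y => c x y + u y :=
    (hcc.comp (Continuous.prodMk_right x)).add hu.continuous
  obtain ⟨y, -, hy⟩ := isCompact_univ.exists_isMinOn ⟨x, Set.mem_univ x⟩ hcont.continuousOn
  refine ⟨y, le_antisymm ((hu.isGLB x).2 ?_) ((hu.isGLB x).1 ⟨y, rfl⟩)⟩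
  rintro _ ⟨y', rfl⟩
  exact hy (Set.mem_univ y')

/-- The additive eigenvalue of the Lax–Oleinik operator is unique. -/
lemma IsWeakKAM.eigenvalue_eq_zero [Nonempty X] {u w : X → ℝ} (hu : IsWeakKAM c u)
    (hw : Continuous w) {t : ℝ}
    (hwt : ∀ x, IsGLB (Set.range fun y => c x y + w y) (w x + t)) : t = 0 := by
  have hcont : Continuous fun x => w x - u x := hw.sub hu.continuous
  obtain ⟨x, -, hx⟩ := isCompact_univ.exists_isMinOn Set.univ_nonempty hcont.continuousOn
  obtain ⟨y, -, hy⟩ := isCompact_univ.exists_isMaxOn Set.univ_nonempty hcont.continuousOn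
  apply le_antisymm
  · have : w y + t - (w y - u y) ≤ u y := (hu.isGLB y).2 <| by
      rintro _ ⟨z, rfl⟩
      have h₁ : w z - u z ≤ w y - u y := hy (Set.mem_univ z)
      have h₂ := (hwt y).1 ⟨z, rfl⟩
      simp only at h₂ ⊢
      linarith
    linarith
  · have : u x + (w x - u x) ≤ w x + t := (hwt x).2 <| by
      rintro _ ⟨z, rfl⟩
      have h₁ : w x - u x ≤ w z - u z := hx (Set.mem_univ z)
      have h₂ := (hu.isGLB x).1 ⟨z, rfl⟩
      simp only at h₂ ⊢
      linarith
    linarith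

/-- Calibrated orbits accumulate only in the Aubry set: two visits near an accumulation point,
with end points moved to that point, close up to a loop of small cost. -/
lemma mem_aubrySet_of_tendsto (hcc : Continuous (Function.uncurry c)) {u : X → ℝ}
    (hu : Continuous u) {p : ℕ → X}
    (hp : ∀ i, c (p i) (p (i + 1)) + u (p (i + 1)) = u (p i)) {z : X} {φ : ℕ → ℕ}
    (hφ : StrictMono φ) (hz : Tendsto (p ∘ φ) atTop (𝓝 z)) : z ∈ aubrySet c := by
  intro ε hε
  have huc := CompactSpace.uniformContinuous_of_continuous hcc
  obtain ⟨δ, hδ, H⟩ := Metric.uniformContinuous_iff.1 huc (ε / 4) (by positivity)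
  have h₁ : ∀ᶠ j in atTop, dist (p (φ j)) z < δ := hz.eventually (Metric.ball_mem_nhds z hδ)
  have h₂ : ∀ᶠ j in atTop, dist (u (p (φ j))) (u z) < ε / 4 :=
    ((hu.tendsto z).comp hz).eventually (Metric.ball_mem_nhds _ (by positivity))
  obtain ⟨j, hj⟩ := (h₁.and h₂).exists_forall_of_atTop
  obtain ⟨k, hk⟩ : ∃ k, φ (j + 3) = φ j + k + 3 := by
    have a₁ := hφ (show j < j + 1 by omega)
    have a₂ := hφ (show j + 1 < j + 2 by omega)
    have a₃ := hφ (show j + 2 < j + 3 by omega)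
    exact ⟨φ (j + 3) - φ j - 3, by omega⟩
  have hm := hj j le_rfl
  have hn := hj (j + 3) (by omega)
  rw [hk] at hn
  have c₁ : dist (c (p (φ j)) (p (φ j + 1))) (c z (p (φ j + 1))) < ε / 4 :=
    H (a := (_, _)) (b := (_, _)) (by simp [Prod.dist_eq, hm.1])
  have c₂ : dist (c (p (φ j + k + 2)) (p (φ j + k + 3))) (c (p (φ j + k + 2)) z) < ε / 4 :=
    H (a := (_, _)) (b := (_, _)) (by simp [Prod.dist_eq, hn.1])
  have e₁ := hp (φ j)
  have e₂ := hp (φ j + k + 2)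
  have ch := (Chain.of_orbit hp (φ j + 1) k)
  rw [show φ j + 1 + k + 1 = φ j + k + 2 by ring] at ch
  refine ⟨_, ?_, (ch.cons z).append (.single _ z)⟩
  have hm₂ := hm.2
  have hn₂ := hn.2
  rw [Real.dist_eq, abs_lt] at c₁ c₂ hm₂ hn₂
  rw [show φ j + k + 2 + 1 = φ j + k + 3 by ring] at e₂
  linarith

lemma IsWeakKAM.sub_le_of_aubrySet (hcc : Continuous (Function.uncurry c)) {u w : X → ℝ}
    (hu : IsWeakKAM c u) (hw : IsWeakKAM c w) {t : ℝ} (ht : ∀ z ∈ aubrySet c, w z - u z ≤ t)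
    (x : X) : w x - u x ≤ t := by
  choose g hg using hu.exists_eq hcc
  let p : ℕ → X := fun n => g^[n] x
  have hp : ∀ i, c (p i) (p (i + 1)) + u (p (i + 1)) = u (p i) := fun i => by
    simp only [p, Function.iterate_succ_apply']
    exact hg _
  obtain ⟨z, φ, hφ, hz⟩ := CompactSpace.tendsto_subseq p
  have hzA := mem_aubrySet_of_tendsto hcc hu.continuous hp hφ hz
  have hmono : ∀ n, w x - u x ≤ w (p n) - u (p n) := fun n => by
    induction n with
    | zero => exact le_rfl
    | succ n ih =>
      have := (hw.isGLB (p n)).1 ⟨p (n + 1), rfl⟩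
      simp only at this
      linarith [hp n]
  have hlim : Tendsto (fun j => w (p (φ j)) - u (p (φ j))) atTop (𝓝 (w z - u z)) :=
    ((hw.continuous.sub hu.continuous).tendsto z).comp hz
  exact (ge_of_tendsto' hlim fun j => hmono _).trans (ht z hzA)

/-- The Aubry set is a set of uniqueness for the fixed points. -/
lemma IsWeakKAM.eq_add_of_aubrySet (hcc : Continuous (Function.uncurry c)) {u w : X → ℝ}
    (hu : IsWeakKAM c u) (hw : IsWeakKAM c w) {t : ℝ} (ht : ∀ z ∈ aubrySet c, w z - u z = t)
    (x : X) : w x = u x + t := by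
  have h₁ := hu.sub_le_of_aubrySet hcc hw (t := t) (fun z hz => (ht z hz).le) x
  have h₂ := hw.sub_le_of_aubrySet hcc hu (t := -t) (fun z hz => by linarith [ht z hz]) x
  linarith

end Abstract

/-! ### The one-step cost on the torus -/

section Cost

variable {N : ℕ}

lemma toTorus_zero : toTorus (0 : Vel N) = 0 := by
  ext i; simp [toTorus]

lemma toTorus_add (y z : Vel N) : toTorus (y + z) = toTorus y + toTorus z := by
  ext i; simp [toTorus]

lemma toTorus_sub (y z : Vel N) : toTorus (y - z) = toTorus y - toTorus z := by
  ext i; simp [toTorus]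

lemma toTorus_intVec (s : Fin N → ℤ) : toTorus (intVec s) = 0 := by
  ext i
  exact (AddCircle.coe_eq_zero_iff (1 : ℝ)).2 ⟨s i, by simp [intVec]⟩

lemma exists_eq_add_intVec {y z : Vel N} (hyz : toTorus y = toTorus z) :
    ∃ s : Fin N → ℤ, y = z + intVec s := by
  have : ∀ i, ∃ n : ℤ, n • (1 : ℝ) = y i - z i := fun i => by
    rw [← AddCircle.coe_eq_zero_iff (1 : ℝ), AddCircle.coe_sub, sub_eq_zero]
    exact congrFun hyz i
  choose s hs using this
  refine ⟨s, ?_⟩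
  ext i
  have := hs i
  simp only [zsmul_eq_mul, mul_one] at this
  simp [intVec, this]

lemma continuous_toTorus : Continuous (toTorus : Vel N → Torus N) :=
  continuous_pi fun i => (AddCircle.continuous_mk' 1).comp (EuclideanSpace.proj i).continuous

lemma exists_toTorus_eq (w : Torus N) : ∃ e : Vel N, toTorus e = w ∧ ‖e‖ ≤ √N := by
  have : ∀ i, ∃ r : ℝ, ((r : ℝ) : UnitAddCircle) = w i ∧ |r| ≤ 1 := fun i => by
    refine ⟨AddCircle.equivIco 1 0 (w i), AddCircle.coe_equivIco, ?_⟩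
    have := (AddCircle.equivIco 1 0 (w i)).2
    rw [abs_le]
    constructor <;> linarith [this.1, this.2]
  choose r hr₁ hr₂ using this
  refine ⟨WithLp.toLp 2 r, funext hr₁, ?_⟩
  rw [EuclideanSpace.norm_eq]
  apply Real.sqrt_le_sqrt
  calc ∑ i, ‖r i‖ ^ 2 ≤ ∑ _i : Fin N, (1 : ℝ) := Finset.sum_le_sum fun i _ => by
        rw [Real.norm_eq_abs]
        exact pow_le_one₀ (abs_nonneg _) (hr₂ i)
    _ = N := by simp

lemma isOpenMap_toTorus : IsOpenMap (toTorus : Vel N → Torus N) := by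
  have h₁ : IsOpenMap (Pi.map (fun (_ : Fin N) (r : ℝ) => (r : UnitAddCircle))) :=
    IsOpenMap.piMap (fun _ => QuotientAddGroup.isOpenMap_coe) (by simp)
  exact h₁.comp (EuclideanSpace.equiv (Fin N) ℝ).toHomeomorph.isOpenMap

/-- Torus elements close to `0` have lifts close to `0`. -/
lemma exists_small_lift {δ : ℝ} (hδ : 0 < δ) :
    ∃ η > 0, ∀ w : Torus N, dist w 0 < η → ∃ e : Vel N, toTorus e = w ∧ ‖e‖ < δ := by
  have : toTorus '' Metric.ball (0 : Vel N) δ ∈ 𝓝 (0 : Torus N) := by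
    have := isOpenMap_toTorus.image_mem_nhds (Metric.ball_mem_nhds (0 : Vel N) hδ)
    rwa [toTorus_zero] at this
  obtain ⟨η, hη, H⟩ := Metric.mem_nhds_iff.1 this
  refine ⟨η, hη, fun w hw => ?_⟩
  obtain ⟨e, he, rfl⟩ := H hw
  exact ⟨e, rfl, by simpa using he⟩

lemma continuous_step (h : ℝ) : Continuous fun q : Torus N × Vel N => step h q.1 q.2 :=
  continuous_fst.add (continuous_toTorus.comp (continuous_snd.const_smul h))

lemma continuous_backStep (h : ℝ) : Continuous fun q : Torus N × Vel N => backStep h q.1 q.2 :=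
  continuous_fst.sub (continuous_toTorus.comp (continuous_snd.const_smul h))

lemma step_backStep (h : ℝ) (x : Torus N) (v : Vel N) : step h (backStep h x v) v = x := by
  simp [step, backStep]

lemma backStep_step (h : ℝ) (x : Torus N) (v : Vel N) : backStep h (step h x v) v = x := by
  simp [step, backStep]

lemma step_add (h : ℝ) (x : Torus N) (v w : Vel N) :
    step h x (v + w) = step h x v + toTorus (h • w) := by
  simp only [step, smul_add, toTorus_add, add_assoc]

/-- The least cost, normalized by the critical value, of moving from `x` to `y` in one step;
the velocity `v` runs over the different lifts of the displacement. -/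
noncomputable def cost (h : ℝ) (L : Torus N → Vel N → ℝ) (x y : Torus N) : ℝ :=
  h * sInf (L x '' {v | step h x v = y}) - h * criticalValue h L

variable {h : ℝ} {L : Torus N → Vel N → ℝ}

lemma IsLagrangian.continuous_right (hL : IsLagrangian L) (x : Torus N) : Continuous (L x) :=
  hL.continuous.comp (Continuous.prodMk_right x)

/-- Linear lower bound of arbitrary slope: superlinearity together with compactness. -/
lemma IsLagrangian.exists_lower_bound (hL : IsLagrangian L) (A : ℝ) :
    ∃ K : ℝ, ∀ x v, A * ‖v‖ - K ≤ L x v := by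
  obtain ⟨R, hR⟩ := hL.superlinear A
  have hcomp : IsCompact ((Set.univ : Set (Torus N)) ×ˢ Metric.closedBall (0 : Vel N) R) :=
    isCompact_univ.prod (isCompact_closedBall _ _)
  have hcont : Continuous fun q : Torus N × Vel N => A * ‖q.2‖ - L q.1 q.2 :=
    (continuous_const.mul continuous_snd.norm).sub hL.continuous
  obtain ⟨K, hK⟩ := hcomp.bddAbove_image hcont.continuousOn
  refine ⟨max K 0, fun x v => ?_⟩
  by_cases hv : R ≤ ‖v‖
  · linarith [hR x v hv, le_max_right K 0]
  · have : A * ‖v‖ - L x v ≤ K :=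
      hK ⟨(x, v), ⟨Set.mem_univ _, by simpa using (not_le.1 hv).le⟩, rfl⟩
    linarith [le_max_left K 0]

lemma exists_step_eq (hh : 0 < h) (x y : Torus N) : ∃ v, step h x v = y ∧ ‖v‖ ≤ √N / h := by
  obtain ⟨e, he, hn⟩ := exists_toTorus_eq (y - x)
  refine ⟨h⁻¹ • e, ?_, ?_⟩
  · simp [step, smul_smul, mul_inv_cancel₀ hh.ne', he]
  · rw [norm_smul, Real.norm_eq_abs, abs_of_pos (inv_pos.2 hh), div_eq_inv_mul]
    gcongr

lemma cost_step_le (hh : 0 < h) (hL : IsLagrangian L) (x : Torus N) (v : Vel N) :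
    cost h L x (step h x v) ≤ h * L x v - h * criticalValue h L := by
  obtain ⟨K, hK⟩ := hL.exists_lower_bound 0
  have : sInf (L x '' {w | step h x w = step h x v}) ≤ L x v :=
    csInf_le ⟨-K, by rintro _ ⟨w, -, rfl⟩; linarith [hK x w]⟩ ⟨v, rfl, rfl⟩
  rw [cost]
  gcongr

/-- The one-step cost is attained, at velocities that are bounded uniformly in the end points. -/
lemma exists_cost_eq (hh : 0 < h) (hL : IsLagrangian L) :
    ∃ R, ∀ x y, ∃ v, step h x v = y ∧ ‖v‖ ≤ R ∧
      cost h L x y = h * L x v - h * criticalValue h L := by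
  have hcomp : IsCompact ((Set.univ : Set (Torus N)) ×ˢ Metric.closedBall (0 : Vel N) (√N / h)) :=
    isCompact_univ.prod (isCompact_closedBall _ _)
  obtain ⟨M, hM⟩ := hcomp.bddAbove_image hL.continuous.continuousOn
  obtain ⟨K, hK⟩ := hL.exists_lower_bound 1
  refine ⟨M + K, fun x y => ?_⟩
  obtain ⟨v₀, hv₀, hn⟩ := exists_step_eq hh x y
  have hMv : L x v₀ ≤ M := hM ⟨(x, v₀), ⟨Set.mem_univ _, by simpa using hn⟩, rfl⟩
  have hclosed : IsClosed {v | step h x v = y} :=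
    isClosed_eq ((continuous_step h).comp (Continuous.prodMk_right x)) continuous_const
  have hcoer : ∀ᶠ v in cocompact (Vel N) ⊓ 𝓟 {v | step h x v = y}, L x v₀ ≤ L x v := by
    apply Filter.Eventually.filter_mono inf_le_left
    filter_upwards [tendsto_norm_cocompact_atTop.eventually_ge_atTop (M + K)] with v hv
    linarith [hK x v]
  obtain ⟨v, hv, hmin⟩ :=
    (hL.continuous_right x).continuousOn.exists_isMinOn' hclosed hv₀ hcoer
  have hle : ∀ w, step h x w = y → L x v ≤ L x w := fun w hw => hmin hw
  refine ⟨v, hv, by linarith [hK x v, hle v₀ hv₀], ?_⟩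
  have : sInf (L x '' {w | step h x w = y}) = L x v :=
    IsLeast.csInf_eq ⟨⟨v, hv, rfl⟩, by rintro _ ⟨w, hw, rfl⟩; exact hle w hw⟩
  rw [cost, this]

lemma continuous_cost (hh : 0 < h) (hL : IsLagrangian L) :
    Continuous (Function.uncurry (cost h L)) := by
  obtain ⟨R, hR⟩ := exists_cost_eq hh hL
  have hcomp : IsCompact ((Set.univ : Set (Torus N)) ×ˢ Metric.closedBall (0 : Vel N) (R + 1)) :=
    isCompact_univ.prod (isCompact_closedBall _ _)
  have huc := hcomp.uniformContinuousOn_of_continuous hL.continuous.continuousOn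
  -- a minimizing velocity between two points is adjusted slightly to join two nearby points
  have key : ∀ ε > 0, ∃ δ > 0, ∀ x y x' y', dist x x' < δ → dist y y' < δ →
      cost h L x' y' ≤ cost h L x y + ε := by
    intro ε hε
    obtain ⟨δ, hδ, H⟩ := Metric.uniformContinuousOn_iff.1 huc (ε / h) (by positivity)
    obtain ⟨η, hη, Hη⟩ := exists_small_lift (N := N) (δ := h * min δ 1) (by positivity)
    refine ⟨min δ (η / 2), by positivity, fun x y x' y' hx hy => ?_⟩
    obtain ⟨v, hv, hvR, hvc⟩ := hR x y
    obtain ⟨e, he, hen⟩ := Hη (y' - y - (x' - x)) (by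
      rw [dist_zero_right]
      calc ‖y' - y - (x' - x)‖ ≤ ‖y' - y‖ + ‖x' - x‖ := norm_sub_le _ _
        _ = dist y y' + dist x x' := by rw [dist_comm y, dist_comm x, dist_eq_norm, dist_eq_norm]
        _ < η / 2 + η / 2 :=
          add_lt_add (hy.trans_le (min_le_right _ _)) (hx.trans_le (min_le_right _ _))
        _ = η := add_halves η)
    have hn : ‖h⁻¹ • e‖ < min δ 1 := by
      rw [norm_smul, Real.norm_eq_abs, abs_of_pos (inv_pos.2 hh), inv_mul_lt_iff₀ hh]
      exact hen
    have hstep : step h x' (v + h⁻¹ • e) = y' := by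
      rw [step_add, smul_smul, mul_inv_cancel₀ hh.ne', one_smul, he, ← hv]
      simp only [step]
      abel
    have hd : dist (L x v) (L x' (v + h⁻¹ • e)) < ε / h := by
      refine H (x, v) ⟨Set.mem_univ _, ?_⟩ (x', v + h⁻¹ • e) ⟨Set.mem_univ _, ?_⟩ ?_
      · simpa using hvR.trans (by linarith)
      · rw [mem_closedBall_zero_iff]
        exact (norm_add_le _ _).trans (add_le_add hvR (hn.le.trans (min_le_right _ _)))
      · rw [Prod.dist_eq]
        refine max_lt (hx.trans_le (min_le_left _ _)) ?_
        simpa using hn.trans_le (min_le_left _ _)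
    have h₁ := cost_step_le hh hL x' (v + h⁻¹ • e)
    rw [hstep] at h₁
    rw [Real.dist_eq, abs_lt] at hd
    have h₂ : h * L x' (v + h⁻¹ • e) ≤ h * (L x v + ε / h) := by
      gcongr
      linarith
    rw [mul_add, mul_div_cancel₀ _ hh.ne'] at h₂
    linarith
  rw [Metric.continuous_iff]
  rintro ⟨x, y⟩ ε hε
  obtain ⟨δ, hδ, H⟩ := key (ε / 2) (half_pos hε)
  refine ⟨δ, hδ, ?_⟩
  rintro ⟨x', y'⟩ hd
  rw [Prod.dist_eq, max_lt_iff] at hd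
  simp only [Function.uncurry] at hd ⊢
  rw [Real.dist_eq, abs_lt]
  constructor <;> linarith [H x' y' x y hd.1 hd.2,
    H x y x' y' (by rw [dist_comm]; exact hd.1) (by rw [dist_comm]; exact hd.2)]

/-- Infima over velocities and infima over end points agree. -/
lemma isGLB_step_iff (hh : 0 < h) (hL : IsLagrangian L) (u : Torus N → ℝ) (x : Torus N) (t : ℝ) :
    IsGLB (Set.range fun v : Vel N => u (step h x v) + h * L x v - h * criticalValue h L) t ↔
      IsGLB (Set.range fun y => cost h L x y + u y) t := by
  obtain ⟨R, hR⟩ := exists_cost_eq hh hL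
  refine isGLB_congr (Set.ext fun b => ⟨?_, ?_⟩)
  · rintro hb _ ⟨y, rfl⟩
    obtain ⟨v, rfl, -, hv⟩ := hR x y
    have := hb ⟨v, rfl⟩
    simp only at this ⊢
    linarith
  · rintro hb _ ⟨v, rfl⟩
    have := hb ⟨step h x v, rfl⟩
    simp only at this ⊢
    linarith [cost_step_le hh hL x v]

lemma isGLB_backStep_iff (hh : 0 < h) (hL : IsLagrangian L) (u : Torus N → ℝ) (x : Torus N)
    (t : ℝ) :
    IsGLB (Set.range fun v : Vel N =>
      u (backStep h x v) + h * L (backStep h x v) v - h * criticalValue h L) t ↔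
      IsGLB (Set.range fun y => flip (cost h L) x y + u y) t := by
  obtain ⟨R, hR⟩ := exists_cost_eq hh hL
  refine isGLB_congr (Set.ext fun b => ⟨?_, ?_⟩)
  · rintro hb _ ⟨y, rfl⟩
    obtain ⟨v, hx, -, hv⟩ := hR y x
    have := hb ⟨v, rfl⟩
    simp only [← hx, backStep_step, flip] at this ⊢
    rw [hx]
    linarith
  · rintro hb _ ⟨v, rfl⟩
    have := hb ⟨backStep h x v, rfl⟩
    have h₁ := cost_step_le hh hL (backStep h x v) v
    rw [step_backStep] at h₁
    simp only [flip] at this ⊢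
    linarith

lemma isCalibrated_iff (hh : 0 < h) (hL : IsLagrangian L) (u : Torus N → ℝ) :
    IsCalibrated h L u ↔ IsWeakKAM (cost h L) u :=
  ⟨fun hu => ⟨hu.continuous, fun x => (isGLB_step_iff hh hL u x _).1 (hu.calibrated x)⟩,
    fun hu => ⟨hu.continuous, fun x => (isGLB_step_iff hh hL u x _).2 (hu.isGLB x)⟩⟩

lemma pathAction_succ (k : ℕ) (p : ℕ → Vel N) :
    pathAction h L (k + 1) p = (h * L (toTorus (p 0)) (h⁻¹ • (p 1 - p 0)) - h * criticalValue h L)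
      + pathAction h L k fun i => p (i + 1) := by
  simp only [pathAction, Finset.sum_range_succ']
  ring

lemma step_inv_smul_sub (hh : 0 < h) (y z : Vel N) :
    step h (toTorus y) (h⁻¹ • (z - y)) = toTorus z := by
  simp [step, smul_smul, mul_inv_cancel₀ hh.ne', toTorus_sub]

/-- A path upstairs projects to a chain whose cost is at most the action of the path. -/
lemma exists_chain_le_pathAction (hh : 0 < h) (hL : IsLagrangian L) (k : ℕ) (p : ℕ → Vel N) :
    ∃ a ≤ pathAction h L (k + 1) p, Chain (cost h L) (toTorus (p 0)) (toTorus (p (k + 1))) a := by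
  induction k generalizing p with
  | zero =>
    refine ⟨_, ?_, .single _ _⟩
    have := cost_step_le hh hL (toTorus (p 0)) (h⁻¹ • (p 1 - p 0))
    rw [step_inv_smul_sub hh] at this
    rw [pathAction_succ]
    simpa [pathAction] using this
  | succ k ih =>
    obtain ⟨a, ha, hch⟩ := ih fun i => p (i + 1)
    refine ⟨_, ?_, hch.cons _⟩
    have := cost_step_le hh hL (toTorus (p 0)) (h⁻¹ • (p 1 - p 0))
    rw [step_inv_smul_sub hh] at this
    rw [pathAction_succ]
    exact add_le_add this ha

/-- A chain lifts, with prescribed end point, to a path whose action is the cost of the chain. -/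
lemma Chain.exists_lift (hh : 0 < h) (hL : IsLagrangian L) {x z : Torus N} {a : ℝ}
    (hch : Chain (cost h L) x z a) (y : Vel N) (hy : toTorus y = z) :
    ∃ k ≥ 1, ∃ p : ℕ → Vel N, toTorus (p 0) = x ∧ p k = y ∧ pathAction h L k p = a := by
  obtain ⟨R, hR⟩ := exists_cost_eq hh hL
  have prepend : ∀ (x : Torus N) (k : ℕ) (p : ℕ → Vel N), ∃ q : Vel N, toTorus q = x ∧
      pathAction h L (k + 1) (fun i => Nat.casesOn i q p)
        = cost h L x (toTorus (p 0)) + pathAction h L k p := fun x k p => by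
    obtain ⟨v, hv, -, hc⟩ := hR x (toTorus (p 0))
    have hq : toTorus (p 0 - h • v) = x := by
      rw [toTorus_sub, ← hv]
      simp [step]
    refine ⟨p 0 - h • v, hq, ?_⟩
    rw [pathAction_succ, hc]
    simp [hq, smul_smul, inv_mul_cancel₀ hh.ne']
  induction hch with
  | single x z =>
    obtain ⟨q, hq, hpa⟩ := prepend x 0 fun _ => y
    exact ⟨1, le_rfl, _, hq, rfl, by rw [hpa, hy]; simp [pathAction]⟩
  | cons x _ ih =>
    obtain ⟨k, hk, p, hp₀, hpk, hpa⟩ := ih hy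
    obtain ⟨q, hq, hpa'⟩ := prepend x k p
    exact ⟨k + 1, by omega, _, hq, hpk, by rw [hpa', hp₀, hpa]⟩

lemma nonWandering_eq_aubrySet (hh : 0 < h) (hL : IsLagrangian L)
    (hc : ∀ x a, Chain (cost h L) x x a → 0 ≤ a) :
    nonWandering h L = aubrySet (cost h L) := by
  ext x
  constructor
  · intro hx ε hε
    obtain ⟨y, hy, -⟩ := exists_toTorus_eq x
    obtain ⟨k, hk, s, p, hp₀, hpk, hp⟩ := hx y hy ε hε
    obtain ⟨k, rfl⟩ : ∃ j, k = j + 1 := ⟨k - 1, by omega⟩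
    obtain ⟨a, ha, hch⟩ := exists_chain_le_pathAction hh hL k p
    rw [hp₀, hpk, toTorus_add, toTorus_intVec, add_zero, hy] at hch
    exact ⟨a, ha.trans_lt (abs_lt.1 hp).2, hch⟩
  · intro hx y hy ε hε
    obtain ⟨a, ha, hch⟩ := hx ε hε
    obtain ⟨k, hk, p, hp₀, hpk, hp⟩ := hch.exists_lift hh hL y hy
    obtain ⟨s, hs⟩ := exists_eq_add_intVec (hp₀.trans hy.symm)
    exact ⟨k, hk, s, p, hs, hpk, by rw [hp, abs_of_nonneg (hc x a hch)]; exact ha⟩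

end Cost

/-! ### Holonomic measures -/

section Measures

variable {N : ℕ} {h : ℝ} {L : Torus N → Vel N → ℝ}

lemma integrable_comp_torus {Y : Type*} [TopologicalSpace Y] [MeasurableSpace Y]
    [OpensMeasurableSpace Y] [SecondCountableTopology Y] {ν : Measure Y} [IsFiniteMeasure ν]
    {f : Torus N → ℝ} (hf : Continuous f) {g : Y → Torus N} (hg : Continuous g) :
    Integrable (fun q => f (g q)) ν := by
  obtain ⟨C, hC⟩ := isCompact_univ.exists_bound_of_continuousOn hf.continuousOn
  exact .of_bound (hf.comp hg).aestronglyMeasurable C (ae_of_all _ fun q => hC _ (Set.mem_univ _))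

/-- A chain carries the sum of the Dirac masses at its points and velocities; its boundary is
the difference of the end points, and its action is the cost of the chain. -/
lemma Chain.exists_measure (hh : 0 < h) (hL : IsLagrangian L) {x y : Torus N} {a : ℝ}
    (hch : Chain (cost h L) x y a) : ∃ ν : Measure (Torus N × Vel N), IsFiniteMeasure ν ∧ ν ≠ 0 ∧
      (∀ φ : C(Torus N, ℝ), ∫ q, (φ (step h q.1 q.2) - φ q.1) ∂ν = φ y - φ x) ∧
      Integrable (fun q : Torus N × Vel N => L q.1 q.2) ν ∧
      a = h * ∫ q, L q.1 q.2 ∂ν - h * criticalValue h L * ν.real Set.univ := by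
  obtain ⟨R, hR⟩ := exists_cost_eq hh hL
  have hint : ∀ (ν : Measure (Torus N × Vel N)) [IsFiniteMeasure ν] (φ : C(Torus N, ℝ)),
      Integrable (fun q : Torus N × Vel N => φ (step h q.1 q.2) - φ q.1) ν := fun ν _ φ =>
    (integrable_comp_torus φ.continuous (continuous_step h)).sub
      (integrable_comp_torus φ.continuous continuous_fst)
  induction hch with
  | single x y =>
    obtain ⟨v, rfl, -, hc⟩ := hR x y
    refine ⟨Measure.dirac (x, v), inferInstance, IsProbabilityMeasure.ne_zero _, fun φ => ?_,
      integrable_dirac (by simp), ?_⟩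
    · rw [integral_dirac]
    · rw [integral_dirac, hc]; simp
  | @cons x y z a _ ih =>
    obtain ⟨ν, hν, hν₀, hb, hi, ha⟩ := ih
    obtain ⟨v, rfl, -, hc⟩ := hR x y
    have hi' : Integrable (fun q : Torus N × Vel N => L q.1 q.2) (Measure.dirac (x, v)) :=
      integrable_dirac (by simp)
    refine ⟨Measure.dirac (x, v) + ν, inferInstance, fun h0 => hν₀ ?_, fun φ => ?_,
      hi'.add_measure hi, ?_⟩
    · exact Measure.measure_univ_eq_zero.1 (by
        have := congrArg (fun m => m Set.univ) h0
        simp at this)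
    · rw [integral_add_measure (hint _ φ) (hint _ φ), hb, integral_dirac]
      ring
    · rw [integral_add_measure hi' hi, integral_dirac, hc, ha, measureReal_add_apply]
      simp
      ring

lemma bddBelow_action (hL : IsLagrangian L) :
    BddBelow {a : ℝ | ∃ μ : Measure (Torus N × Vel N), IsAdmissible h L μ ∧ a = action L μ} := by
  obtain ⟨K, hK⟩ := hL.exists_lower_bound 0
  refine ⟨-K, ?_⟩
  rintro _ ⟨μ, hμ, rfl⟩
  have := hμ.1.isProbabilityMeasure
  calc -K = ∫ _q : Torus N × Vel N, -K ∂μ := by simp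
    _ ≤ action L μ := integral_mono (integrable_const _) hμ.2 fun q => by
      simpa using hK q.1 q.2

/-- Loops have nonnegative normalized cost, because a loop defines a holonomic measure. -/
lemma Chain.nonneg (hh : 0 < h) (hL : IsLagrangian L) {x : Torus N} {a : ℝ}
    (hch : Chain (cost h L) x x a) : 0 ≤ a := by
  obtain ⟨ν, hν, hν₀, hb, hi, ha⟩ := hch.exists_measure hh hL
  have hνu : ν Set.univ ≠ 0 := by simpa using hν₀
  have hpos : 0 < ν.real Set.univ := ENNReal.toReal_pos hνu (measure_ne_top _ _)
  have hadm : IsAdmissible h L ((ν Set.univ)⁻¹ • ν) := by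
    refine ⟨⟨⟨?_⟩, fun φ => ?_⟩, hi.smul_measure (ENNReal.inv_ne_top.2 hνu)⟩
    · simp [ENNReal.inv_mul_cancel hνu (measure_ne_top _ _)]
    · rw [integral_smul_measure, hb]; simp
  have h₁ : criticalValue h L ≤ action L ((ν Set.univ)⁻¹ • ν) :=
    csInf_le (bddBelow_action hL) ⟨_, hadm, rfl⟩
  rw [action, integral_smul_measure, ENNReal.toReal_inv, smul_eq_mul, ← measureReal_def,
    le_inv_mul_iff₀ hpos] at h₁
  rw [ha]
  have := mul_le_mul_of_nonneg_left h₁ hh.le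
  linarith

lemma IsMather.action_eq {μ : Measure (Torus N × Vel N)} (hμ : IsMather h L μ) :
    action L μ = criticalValue h L := by
  symm
  refine IsLeast.csInf_eq ⟨⟨μ, hμ.1, rfl⟩, ?_⟩
  rintro _ ⟨ν, hν, rfl⟩
  exact hμ.2 ν hν

/-- Subactions are calibrated along Mather measures. -/
lemma IsMather.ae_calibrated {μ : Measure (Torus N × Vel N)}
    (hμ : IsMather h L μ) {u : Torus N → ℝ} (hu : Continuous u)
    (hsub : ∀ x v, u x ≤ u (step h x v) + h * L x v - h * criticalValue h L) :
    ∀ᵐ q ∂μ, u q.1 = u (step h q.1 q.2) + h * L q.1 q.2 - h * criticalValue h L := by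
  have := hμ.1.1.isProbabilityMeasure
  have i₁ : Integrable (fun q : Torus N × Vel N => u (step h q.1 q.2) - u q.1) μ :=
    (integrable_comp_torus hu (continuous_step h)).sub (integrable_comp_torus hu continuous_fst)
  have i₂ : Integrable (fun q : Torus N × Vel N => h * L q.1 q.2 - h * criticalValue h L) μ :=
    (hμ.1.2.const_mul h).sub (integrable_const _)
  have h₀ : ∫ q, ((u (step h q.1 q.2) - u q.1) +
      (h * L q.1 q.2 - h * criticalValue h L)) ∂μ = 0 := by
    rw [integral_add i₁ i₂, integral_sub (hμ.1.2.const_mul h) (integrable_const _),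
      integral_const_mul]
    have h₁ := hμ.1.1.holonomic ⟨u, hu⟩
    have h₂ := hμ.action_eq
    simp only [ContinuousMap.coe_mk] at h₁
    rw [action] at h₂
    simp [h₁, h₂]
  have i₃ : Integrable (fun q : Torus N × Vel N => (u (step h q.1 q.2) - u q.1) +
      (h * L q.1 q.2 - h * criticalValue h L)) μ := i₁.add i₂
  rw [integral_eq_zero_iff_of_nonneg (fun q => by
    simp only [Pi.zero_apply]; linarith [hsub q.1 q.2]) i₃] at h₀
  filter_upwards [h₀] with q hq
  simp only [Pi.zero_apply] at hq
  linarith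

/-- Uniqueness of the Mather measure acts as ergodicity: a continuous function invariant almost
everywhere is constant on the projected support, since any density built from it produces another
Mather measure. -/
lemma IsMather.const_of_unique (hh : 0 < h)
    {μ : Measure (Torus N × Vel N)} (hμ : IsMather h L μ) (huniq : ∀ ν, IsMather h L ν → ν = μ)
    {u w : Torus N → ℝ} (hu : Continuous u) (hw : Continuous w)
    (hus : ∀ x v, u x ≤ u (step h x v) + h * L x v - h * criticalValue h L)
    (hws : ∀ x v, w x ≤ w (step h x v) + h * L x v - h * criticalValue h L) :
    ∃ t, ∀ z ∈ Prod.fst '' μ.support, w z - u z = t := by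
  have := hμ.1.1.isProbabilityMeasure
  have hcal := hμ.ae_calibrated hu hus
  have hcalw := hμ.ae_calibrated hw hws
  obtain ⟨C, hC⟩ := isCompact_univ.exists_bound_of_continuousOn (hw.sub hu).continuousOn
  -- the shift makes `G` positive, hence usable as a density
  let G : Torus N → ℝ := fun x => w x - u x + (C + 1)
  have hG : Continuous G := (hw.sub hu).add continuous_const
  have hG1 : ∀ x, 1 ≤ G x := fun x => by
    have := hC x (Set.mem_univ x)
    rw [Real.norm_eq_abs, abs_le, Pi.sub_apply] at this
    simp only [G]
    linarith [this.1]
  have hGinv : ∀ᵐ q ∂μ, G (step h q.1 q.2) = G q.1 := by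
    filter_upwards [hcal, hcalw] with q h₁ h₂
    simp only [G]
    linarith
  have hGi : Integrable (fun q : Torus N × Vel N => G q.1) μ :=
    integrable_comp_torus hG continuous_fst
  set Z : ℝ := ∫ q, G q.1 ∂μ with hZ
  have hZ1 : 1 ≤ Z := by
    calc (1 : ℝ) = ∫ _q : Torus N × Vel N, (1 : ℝ) ∂μ := by simp
      _ ≤ Z := integral_mono (integrable_const _) hGi fun q => hG1 q.1
  have hZ0 : 0 < Z := by linarith
  let d : Torus N × Vel N → ENNReal := fun q => ENNReal.ofReal (G q.1 / Z)
  have hd : Measurable d :=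
    ((hG.comp continuous_fst).div_const Z).measurable.ennreal_ofReal
  have hdr : ∀ q, (d q).toReal = G q.1 / Z := fun q =>
    ENNReal.toReal_ofReal (div_nonneg (by linarith [hG1 q.1]) hZ0.le)
  have hdlt : ∀ᵐ q ∂μ, d q < ⊤ := ae_of_all _ fun q => ENNReal.ofReal_lt_top
  let ν := μ.withDensity d
  have hνint : ∀ f : Torus N × Vel N → ℝ, ∫ q, f q ∂ν = ∫ q, G q.1 / Z * f q ∂μ := fun f => by
    rw [integral_withDensity_eq_integral_toReal_smul hd hdlt]
    simp only [hdr, smul_eq_mul]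
  have hνprob : IsProbabilityMeasure ν := by
    refine ⟨?_⟩
    rw [withDensity_apply _ MeasurableSet.univ, Measure.restrict_univ,
      ← ofReal_integral_eq_lintegral_ofReal (hGi.div_const Z)
        (ae_of_all _ fun q => div_nonneg (by linarith [hG1 q.1]) hZ0.le),
      integral_div, ← hZ, div_self hZ0.ne', ENNReal.ofReal_one]
  have hνhol : IsHolonomic h ν := by
    refine ⟨hνprob, fun φ => ?_⟩
    rw [hνint]
    have h₁ := hμ.1.1.holonomic ⟨fun x => G x / Z * φ x, (hG.div_const Z).mul φ.continuous⟩
    rw [← h₁]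
    refine integral_congr_ae ?_
    filter_upwards [hGinv] with q hq
    simp only [ContinuousMap.coe_mk, hq]
    ring
  have hνadm : IsAdmissible h L ν := by
    refine ⟨hνhol, (integrable_withDensity_iff_integrable_smul' hd hdlt).2 ?_⟩
    simp only [hdr, smul_eq_mul]
    obtain ⟨D, hD⟩ := isCompact_univ.exists_bound_of_continuousOn (hG.div_const Z).continuousOn
    exact hμ.1.2.bdd_mul ((hG.div_const Z).comp continuous_fst).aestronglyMeasurable
      (ae_of_all _ fun q => hD q.1 (Set.mem_univ _))
  have hνmather : IsMather h L ν := by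
    refine ⟨hνadm, fun ν' hν' => le_trans (le_of_eq ?_) (hμ.2 ν' hν')⟩
    have h₁ := hνhol.holonomic ⟨u, hu⟩
    simp only [ContinuousMap.coe_mk] at h₁
    have h₂ : action L ν = ∫ q, (criticalValue h L
        - h⁻¹ * (u (step h q.1 q.2) - u q.1)) ∂ν := by
      refine integral_congr_ae ?_
      filter_upwards [(withDensity_absolutelyContinuous μ d).ae_le hcal] with q hq
      rw [hq]
      field_simp
      ring
    have hi : Integrable (fun q : Torus N × Vel N => u (step h q.1 q.2) - u q.1) ν :=
      (integrable_comp_torus hu (continuous_step h)).sub (integrable_comp_torus hu continuous_fst)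
    rw [h₂, integral_sub (integrable_const _) (hi.const_mul _), integral_const_mul, h₁,
      hμ.action_eq]
    simp
  -- equality of the two measures forces the variance of `G` to vanish
  have hνμ := huniq ν hνmather
  have hGG : Integrable (fun q : Torus N × Vel N => G q.1 * G q.1) μ :=
    integrable_comp_torus (hG.mul hG) continuous_fst
  have hsq : ∫ q, G q.1 * G q.1 ∂μ = Z * Z := by
    have h₁ := hνint fun q => G q.1
    rw [hνμ, ← hZ] at h₁
    have h₂ : ∫ q, G q.1 * G q.1 ∂μ = ∫ q, Z * (G q.1 / Z * G q.1) ∂μ := by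
      congr 1
      ext q
      field_simp
    rw [h₂, integral_const_mul, ← h₁]
  have hdev : Integrable (fun q : Torus N × Vel N => G q.1 * G q.1 - 2 * Z * G q.1) μ :=
    hGG.sub (hGi.const_mul _)
  have hdev' : Integrable (fun q : Torus N × Vel N =>
      G q.1 * G q.1 - 2 * Z * G q.1 + Z * Z) μ := hdev.add (integrable_const _)
  have hvar : ∫ q, (G q.1 * G q.1 - 2 * Z * G q.1 + Z * Z) ∂μ = 0 := by
    rw [integral_add hdev (integrable_const _),
      integral_sub hGG (hGi.const_mul _), integral_const_mul, hsq, ← hZ]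
    simp
    ring
  rw [integral_eq_zero_iff_of_nonneg (fun q => by
    simp only [Pi.zero_apply]; nlinarith [sq_nonneg (G q.1 - Z)]) hdev'] at hvar
  have hsupp : μ.support ⊆ {q | G q.1 = Z} := by
    refine Measure.support_subset_of_isClosed
      (isClosed_eq (hG.comp continuous_fst) continuous_const) ?_
    filter_upwards [hvar] with q hq
    simp only [Pi.zero_apply] at hq
    have : (G q.1 - Z) ^ 2 = 0 := by linarith [hq]
    exact sub_eq_zero.1 (pow_eq_zero_iff two_ne_zero |>.1 this)
  refine ⟨Z - (C + 1), ?_⟩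
  rintro _ ⟨q, hq, rfl⟩
  have := hsupp hq
  simp only [G, Set.mem_ofPred_eq] at this
  linarith

end Measures

/-! ### Laplace asymptotics -/

section Laplace

variable {N : ℕ}

lemma integrable_exp_neg_norm : Integrable fun v : Vel N => Real.exp (-‖v‖) := by
  have h₁ := integrable_one_add_norm (E := Vel N) (μ := volume) (r := (N : ℝ) + 1) (by simp)
  refine (h₁.const_mul ((N + 1).factorial * Real.exp 1)).mono'
    (by fun_prop) (ae_of_all _ fun v => ?_)
  have hpos : (0 : ℝ) < 1 + ‖v‖ := by positivity
  have hexp := Real.pow_div_factorial_le_exp (1 + ‖v‖) hpos.le (N + 1)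
  rw [Real.norm_eq_abs, Real.abs_exp, Real.rpow_neg hpos.le,
    show (N : ℝ) + 1 = ((N + 1 : ℕ) : ℝ) by push_cast; rfl, Real.rpow_natCast,
    ← div_eq_mul_inv, le_div_iff₀ (by positivity)]
  rw [div_le_iff₀ (by positivity)] at hexp
  calc Real.exp (-‖v‖) * (1 + ‖v‖) ^ (N + 1)
      ≤ Real.exp (-‖v‖) * (Real.exp (1 + ‖v‖) * (N + 1).factorial) := by gcongr
    _ = (N + 1).factorial * (Real.exp (-‖v‖) * Real.exp (1 + ‖v‖)) := by ring
    _ = (N + 1).factorial * Real.exp 1 := by rw [← Real.exp_add]; ring_nf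

/-- Laplace's method: if the phases `Fₙ` converge uniformly to a phase `F` of linear growth, the
logarithmic integrals converge to the minimum of `F`. -/
lemma tendsto_neg_mul_log_integral_exp {F : Vel N → ℝ} (hF : Continuous F) {K : ℝ}
    (hK : ∀ v, ‖v‖ - K ≤ F v) {Fn : ℕ → Vel N → ℝ} (hFn : ∀ n, Continuous (Fn n))
    (hunif : TendstoUniformly Fn F atTop) {τ : ℕ → ℝ} (hτ₀ : ∀ n, 0 < τ n)
    (hτ : Tendsto τ atTop (𝓝 0)) {m : ℝ} (hm : IsGLB (Set.range F) m) :
    Tendsto (fun n => -τ n * Real.log (∫ v, Real.exp (-(Fn n v / τ n)))) atTop (𝓝 m) := by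
  have hint : Integrable fun v => Real.exp (-(F v - m)) := by
    refine (integrable_exp_neg_norm.const_mul (Real.exp (K + m))).mono'
      (by fun_prop) (ae_of_all _ fun v => ?_)
    rw [Real.norm_eq_abs, Real.abs_exp, ← Real.exp_add]
    exact Real.exp_le_exp.2 (by linarith [hK v])
  set J := ∫ v, Real.exp (-(F v - m)) with hJ
  have hJ0 : 0 < J := integral_exp_pos hint
  rw [Metric.tendsto_atTop']
  intro δ hδ
  -- a ball on which the phase is nearly minimal
  obtain ⟨_, ⟨v₀, rfl⟩, -, hv₀⟩ := hm.exists_between (show m < m + δ / 4 by linarith)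
  have hopen : F ⁻¹' Set.Iio (m + δ / 4) ∈ 𝓝 v₀ := (isOpen_Iio.preimage hF).mem_nhds hv₀
  obtain ⟨r, hr, hball⟩ := Metric.mem_nhds_iff.1 hopen
  set B := volume.real (Metric.ball v₀ r) with hB
  have hB0 : 0 < B :=
    ENNReal.toReal_pos (Metric.measure_ball_pos _ _ hr).ne' measure_ball_lt_top.ne
  have e₁ : Tendsto (fun n => τ n * Real.log J) atTop (𝓝 0) := by
    simpa using hτ.mul_const (Real.log J)
  have e₂ : Tendsto (fun n => τ n * Real.log B) atTop (𝓝 0) := by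
    simpa using hτ.mul_const (Real.log B)
  have h₃ := Metric.tendstoUniformly_iff.1 hunif (δ / 4) (by positivity)
  have h₄ := hτ.eventually (gt_mem_nhds (show (0 : ℝ) < 1 by norm_num))
  have h₁ := e₁.eventually (gt_mem_nhds (show (0 : ℝ) < δ / 4 by positivity))
  have h₂ := e₂.eventually (lt_mem_nhds (show -(δ / 4) < (0 : ℝ) by linarith))
  obtain ⟨n₀, H⟩ := ((h₁.and h₂).and (h₃.and h₄)).exists_forall_of_atTop
  refine ⟨n₀, fun n hn => ?_⟩
  obtain ⟨⟨a₁, a₂⟩, a₃, a₄⟩ := H n hn.le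
  have ht := hτ₀ n
  have hclose : ∀ v, |F v - Fn n v| < δ / 4 := fun v => by simpa [Real.dist_eq] using a₃ v
  have hup : ∀ v, Real.exp (-(Fn n v / τ n))
      ≤ Real.exp (-((m - δ / 4) / τ n)) * Real.exp (-(F v - m)) := fun v => by
    rw [← Real.exp_add]
    apply Real.exp_le_exp.2
    have b₁ := (abs_lt.1 (hclose v)).2
    have b₂ : m ≤ F v := hm.1 ⟨v, rfl⟩
    have b₃ : F v - m ≤ (F v - m) / τ n := le_div_self (by linarith) ht a₄.le
    have b₄ : (F v - δ / 4) / τ n ≤ Fn n v / τ n := by gcongr; linarith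
    have b₅ : (F v - δ / 4) / τ n = (F v - m) / τ n + (m - δ / 4) / τ n := by ring
    linarith
  have hintn : Integrable fun v => Real.exp (-(Fn n v / τ n)) :=
    (hint.const_mul (Real.exp (-((m - δ / 4) / τ n)))).mono'
      (Real.continuous_exp.comp ((hFn n).div_const _).neg).aestronglyMeasurable
      (ae_of_all _ fun v => by rw [Real.norm_eq_abs, Real.abs_exp]; exact hup v)
  set I := ∫ v, Real.exp (-(Fn n v / τ n)) with hI
  have hI0 : 0 < I := integral_exp_pos hintn
  have hIle : I ≤ Real.exp (-((m - δ / 4) / τ n)) * J := by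
    rw [hJ, ← integral_const_mul]
    exact integral_mono hintn (hint.const_mul _) hup
  have hIge : Real.exp (-((m + δ / 2) / τ n)) * B ≤ I := by
    calc Real.exp (-((m + δ / 2) / τ n)) * B
        = ∫ _v in Metric.ball v₀ r, Real.exp (-((m + δ / 2) / τ n)) := by
          rw [setIntegral_const, smul_eq_mul, mul_comm]
      _ ≤ ∫ v in Metric.ball v₀ r, Real.exp (-(Fn n v / τ n)) := by
          refine setIntegral_mono_on (integrableOn_const measure_ball_lt_top.ne)
            hintn.integrableOn measurableSet_ball fun v hv => Real.exp_le_exp.2 ?_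
          have b₁ : F v < m + δ / 4 := hball hv
          have b₂ := (abs_lt.1 (hclose v)).1
          have : Fn n v / τ n ≤ (m + δ / 2) / τ n := by gcongr; linarith
          linarith
      _ ≤ I := setIntegral_le_integral hintn (ae_of_all _ fun v => (Real.exp_pos _).le)
  have l₁ : Real.log I ≤ -((m - δ / 4) / τ n) + Real.log J := by
    rw [← Real.log_exp (-((m - δ / 4) / τ n)), ← Real.log_mul (Real.exp_pos _).ne' hJ0.ne']
    exact Real.log_le_log hI0 hIle
  have l₂ : -((m + δ / 2) / τ n) + Real.log B ≤ Real.log I := by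
    rw [← Real.log_exp (-((m + δ / 2) / τ n)), ← Real.log_mul (Real.exp_pos _).ne' hB0.ne']
    exact Real.log_le_log (by positivity) hIge
  have l₁' := mul_le_mul_of_nonneg_left l₁ ht.le
  have l₂' := mul_le_mul_of_nonneg_left l₂ ht.le
  rw [mul_add, mul_neg, mul_div_cancel₀ _ ht.ne'] at l₁' l₂'
  rw [Real.dist_eq, abs_lt]
  constructor <;> linarith

/-- The normalization of the densities becomes, in the limit, the condition that the phase
has minimum zero. -/
lemma isLeast_zero_of_integral_exp_eq_one {g : Torus N → ℝ} {gn : ℕ → Torus N → ℝ}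
    (hgn : ∀ n, Continuous (gn n)) (hunif : TendstoUniformly gn g atTop) {τ : ℕ → ℝ}
    (hτ₀ : ∀ n, 0 < τ n) (hτ : Tendsto τ atTop (𝓝 0))
    (hone : ∀ n, ∫ x, Real.exp (-(gn n x / τ n)) = 1) : IsLeast (Set.range g) 0 := by
  have hg : Continuous g := hunif.continuous (Frequently.of_forall hgn)
  obtain ⟨x₀, -, hx₀⟩ := isCompact_univ.exists_isMinOn Set.univ_nonempty hg.continuousOn
  have : IsProbabilityMeasure (volume : Measure UnitAddCircle) := ⟨UnitAddCircle.measure_univ⟩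
  have hmin : ∀ x, g x₀ ≤ g x := fun x => hx₀ (Set.mem_univ x)
  have hint : ∀ n, Integrable fun x => Real.exp (-(gn n x / τ n)) := fun n =>
    integrable_comp_torus (Real.continuous_exp.comp ((hgn n).div_const _).neg) continuous_id
  suffices h₀ : g x₀ = 0 from ⟨⟨x₀, h₀⟩, by rintro _ ⟨x, rfl⟩; exact h₀ ▸ hmin x⟩
  apply le_antisymm
  · by_contra! hpos
    obtain ⟨n, hn⟩ := (Metric.tendstoUniformly_iff.1 hunif (g x₀ / 2) (by positivity)).exists
    have : ∀ x, Real.exp (-(gn n x / τ n)) ≤ Real.exp (-(g x₀ / 2 / τ n)) := fun x => by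
      have b₁ := hn x
      rw [Real.dist_eq, abs_lt] at b₁
      have := hτ₀ n
      have b₂ : g x₀ / 2 / τ n ≤ gn n x / τ n := by
        gcongr
        linarith [hmin x, b₁.2]
      exact Real.exp_le_exp.2 (by linarith)
    have h₁ := integral_mono (hint n) (integrable_const _) this
    rw [hone n] at h₁
    have h₂ : Real.exp (-(g x₀ / 2 / τ n)) < 1 := by
      rw [Real.exp_lt_one_iff]
      have := div_pos (half_pos hpos) (hτ₀ n)
      linarith
    rw [integral_const, smul_eq_mul, probReal_univ, one_mul] at h₁
    linarith
  · by_contra! hneg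
    set U : Set (Torus N) := g ⁻¹' Set.Iio (g x₀ / 2)
    have hU : IsOpen U := isOpen_Iio.preimage hg
    have hUpos : 0 < volume.real U := ENNReal.toReal_pos
      (hU.measure_pos _ ⟨x₀, show g x₀ < g x₀ / 2 by linarith⟩).ne' (measure_ne_top _ _)
    have hunb : Tendsto (fun n => (-(g x₀ / 4)) * (τ n)⁻¹) atTop atTop :=
      (tendsto_inv_nhdsGT_zero.comp (tendsto_nhdsWithin_iff.2
        ⟨hτ, Eventually.of_forall hτ₀⟩)).const_mul_atTop (by linarith)
    have hbig := hunb.eventually_gt_atTop (Real.log (volume.real U)⁻¹)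
    obtain ⟨n, hn, hnb⟩ :=
      ((Metric.tendstoUniformly_iff.1 hunif (-(g x₀ / 4)) (by linarith)).and hbig).exists
    have h₁ : Real.exp (-(g x₀ / 4) * (τ n)⁻¹) * volume.real U ≤ 1 := by
      calc Real.exp (-(g x₀ / 4) * (τ n)⁻¹) * volume.real U
          = ∫ _x in U, Real.exp (-(g x₀ / 4) * (τ n)⁻¹) := by
            rw [setIntegral_const, smul_eq_mul, mul_comm]
        _ ≤ ∫ x in U, Real.exp (-(gn n x / τ n)) := by
            refine setIntegral_mono_on (integrableOn_const (measure_ne_top _ _))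
              (hint n).integrableOn hU.measurableSet fun x hx => Real.exp_le_exp.2 ?_
            have b₁ : g x < g x₀ / 2 := hx
            have b₂ := hn x
            rw [Real.dist_eq, abs_lt] at b₂
            have := hτ₀ n
            have b₃ : gn n x / τ n ≤ g x₀ / 4 / τ n := by
              gcongr
              linarith [b₂.1]
            rw [neg_mul, ← div_eq_mul_inv]
            linarith
        _ ≤ ∫ x, Real.exp (-(gn n x / τ n)) :=
            setIntegral_le_integral (hint n) (ae_of_all _ fun v => (Real.exp_pos _).le)
        _ = 1 := hone n
    have h₂ := (Real.log_lt_iff_lt_exp (inv_pos.2 hUpos)).1 hnb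
    rw [inv_lt_iff_one_lt_mul₀ hUpos] at h₂
    linarith

end Laplace

/-! ### Vanishing entropy limits -/

section Limits

variable {N : ℕ} {h : ℝ} {L : Torus N → Vel N → ℝ}

lemma tendsto_entropyOp (hh : 0 < h) (hL : IsLagrangian L) {ε : ℕ → ℝ} (hε : ∀ n, 0 < ε n)
    (hε₀ : Tendsto ε atTop (𝓝 0)) {φ : ℕ → Torus N → ℝ} {φ₀ : Torus N → ℝ}
    (hφ : ∀ n, Continuous (φ n)) (hunif : TendstoUniformly φ φ₀ atTop) (x : Torus N) {m : ℝ}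
    (hm : IsGLB (Set.range fun v => h * L x v + φ₀ (step h x v)) m) :
    Tendsto (fun n => entropyOp (ε n) h L (φ n) x) atTop (𝓝 m) := by
  have hφ₀ : Continuous φ₀ := hunif.continuous (Frequently.of_forall hφ)
  obtain ⟨K, hK⟩ := hL.exists_lower_bound h⁻¹
  obtain ⟨C, hC⟩ := isCompact_univ.exists_bound_of_continuousOn hφ₀.continuousOn
  have hstep : Continuous (step h x) := (continuous_step h).comp (Continuous.prodMk_right x)
  have hLx := hL.continuous_right x
  refine tendsto_neg_mul_log_integral_exp (K := h * K + C)
    (F := fun v => h * L x v + φ₀ (step h x v))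
    (Fn := fun n v => h * L x v + φ n (step h x v)) (τ := fun n => ε n * h)
    ((continuous_const.mul hLx).add (hφ₀.comp hstep)) (fun v => ?_)
    (fun n => (continuous_const.mul hLx).add ((hφ n).comp hstep)) ?_
    (fun n => mul_pos (hε n) hh) (by simpa using hε₀.mul_const h) hm
  · have h₁ := mul_le_mul_of_nonneg_left (hK x v) hh.le
    rw [mul_sub, ← mul_assoc, mul_inv_cancel₀ hh.ne', one_mul] at h₁
    have h₂ := (abs_le.1 (hC (step h x v) (Set.mem_univ _))).1
    linarith
  · rw [Metric.tendstoUniformly_iff] at hunif ⊢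
    intro δ hδ
    filter_upwards [hunif δ hδ] with n hn v
    simpa using hn (step h x v)

lemma tendsto_entropyOpBack (hh : 0 < h) (hL : IsLagrangian L) {ε : ℕ → ℝ} (hε : ∀ n, 0 < ε n)
    (hε₀ : Tendsto ε atTop (𝓝 0)) {φ : ℕ → Torus N → ℝ} {φ₀ : Torus N → ℝ}
    (hφ : ∀ n, Continuous (φ n)) (hunif : TendstoUniformly φ φ₀ atTop) (x : Torus N) {m : ℝ}
    (hm : IsGLB (Set.range fun v => h * L (backStep h x v) v + φ₀ (backStep h x v)) m) :
    Tendsto (fun n => entropyOpBack (ε n) h L (φ n) x) atTop (𝓝 m) := by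
  have hφ₀ : Continuous φ₀ := hunif.continuous (Frequently.of_forall hφ)
  obtain ⟨K, hK⟩ := hL.exists_lower_bound h⁻¹
  obtain ⟨C, hC⟩ := isCompact_univ.exists_bound_of_continuousOn hφ₀.continuousOn
  have hstep : Continuous (backStep h x) :=
    (continuous_backStep h).comp (Continuous.prodMk_right x)
  have hLx : Continuous fun v => L (backStep h x v) v :=
    hL.continuous.comp (hstep.prodMk continuous_id)
  refine tendsto_neg_mul_log_integral_exp (K := h * K + C)
    (F := fun v => h * L (backStep h x v) v + φ₀ (backStep h x v))
    (Fn := fun n v => h * L (backStep h x v) v + φ n (backStep h x v)) (τ := fun n => ε n * h)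
    ((continuous_const.mul hLx).add (hφ₀.comp hstep)) (fun v => ?_)
    (fun n => (continuous_const.mul hLx).add ((hφ n).comp hstep)) ?_
    (fun n => mul_pos (hε n) hh) (by simpa using hε₀.mul_const h) hm
  · have h₁ := mul_le_mul_of_nonneg_left (hK (backStep h x v) v) hh.le
    rw [mul_sub, ← mul_assoc, mul_inv_cancel₀ hh.ne', one_mul] at h₁
    have h₂ := (abs_le.1 (hC (backStep h x v) (Set.mem_univ _))).1
    linarith
  · rw [Metric.tendstoUniformly_iff] at hunif ⊢
    intro δ hδ
    filter_upwards [hunif δ hδ] with n hn v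
    simpa using hn (backStep h x v)

/-- The Lax–Oleinik infimum of a continuous function exists. -/
lemma exists_isGLB_add {c : Torus N → Torus N → ℝ} (hc : Continuous (Function.uncurry c))
    {f : Torus N → ℝ} (hf : Continuous f) (x : Torus N) :
    ∃ m, IsGLB (Set.range fun y => c x y + f y) m := by
  have : Continuous fun y => c x y + f y := (hc.comp (Continuous.prodMk_right x)).add hf
  exact ⟨_, isGLB_csInf (Set.range_nonempty _) (isCompact_range this).bddBelow⟩

/-- If `φₙ + λₙ` converges pointwise to the Lax–Oleinik image of the limit `φ₀` of `φₙ`, shifted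
by `t`, then `φ₀` is a fixed point: the limiting additive eigenvalue can only be zero. -/
lemma isWeakKAM_of_tendsto {c : Torus N → Torus N → ℝ} (hc : Continuous (Function.uncurry c))
    {u : Torus N → ℝ} (hu : IsWeakKAM c u) {φ : ℕ → Torus N → ℝ} {φ₀ : Torus N → ℝ}
    (hφ₀ : Continuous φ₀) (hunif : TendstoUniformly φ φ₀ atTop) {lam : ℕ → ℝ} {t : ℝ}
    (hlim : ∀ x m, IsGLB (Set.range fun y => c x y + φ₀ y) m →
      Tendsto (fun n => φ n x + lam n) atTop (𝓝 (m + t))) : IsWeakKAM c φ₀ := by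
  choose m hm using exists_isGLB_add hc hφ₀
  have hlam : ∀ x, Tendsto lam atTop (𝓝 (m x + t - φ₀ x)) := fun x => by
    simpa using (hlim x _ (hm x)).sub (hunif.tendsto_at x)
  -- the limit of `lam` does not depend on the point at which it is computed
  have hconst : ∀ x, m x = φ₀ x + (m 0 - φ₀ 0) := fun x => by
    linarith [tendsto_nhds_unique (hlam x) (hlam 0)]
  have h₀ := hu.eigenvalue_eq_zero hφ₀ fun x => hconst x ▸ hm x
  refine ⟨hφ₀, fun x => ?_⟩
  have := hm x
  rwa [hconst x, h₀, add_zero] at this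

lemma isWeakKAM_of_entropy (hh : 0 < h) (hL : IsLagrangian L) {u : Torus N → ℝ}
    (hu : IsWeakKAM (cost h L) u) {ε : ℕ → ℝ} (hε : ∀ n, 0 < ε n)
    (hε₀ : Tendsto ε atTop (𝓝 0)) {φ : ℕ → Torus N → ℝ} {φ₀ : Torus N → ℝ} {lam : ℕ → ℝ}
    (hφ : ∀ n, Continuous (φ n)) (hunif : TendstoUniformly φ φ₀ atTop)
    (hfix : ∀ n x, entropyOp (ε n) h L (φ n) x = φ n x + lam n) : IsWeakKAM (cost h L) φ₀ := by
  refine isWeakKAM_of_tendsto (continuous_cost hh hL) hu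
    (hunif.continuous (Frequently.of_forall hφ)) hunif (lam := lam) (t := h * criticalValue h L)
    fun x m hm => ?_
  simp only [← hfix]
  refine tendsto_entropyOp hh hL hε hε₀ hφ hunif x ?_
  rw [← isGLB_step_iff hh hL] at hm
  refine ⟨?_, fun b hb => ?_⟩
  · rintro _ ⟨v, rfl⟩
    have := hm.1 ⟨v, rfl⟩
    simp only at this ⊢
    linarith
  · rw [← sub_le_iff_le_add]
    refine hm.2 ?_
    rintro _ ⟨v, rfl⟩
    have := hb ⟨v, rfl⟩
    simp only at this ⊢
    linarith

lemma isWeakKAM_flip_of_entropyBack (hh : 0 < h) (hL : IsLagrangian L) {u : Torus N → ℝ}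
    (hu : IsWeakKAM (flip (cost h L)) u) {ε : ℕ → ℝ} (hε : ∀ n, 0 < ε n)
    (hε₀ : Tendsto ε atTop (𝓝 0)) {φ : ℕ → Torus N → ℝ} {φ₀ : Torus N → ℝ} {lam : ℕ → ℝ}
    (hφ : ∀ n, Continuous (φ n)) (hunif : TendstoUniformly φ φ₀ atTop)
    (hfix : ∀ n x, entropyOpBack (ε n) h L (φ n) x = φ n x + lam n) :
    IsWeakKAM (flip (cost h L)) φ₀ := by
  refine isWeakKAM_of_tendsto (continuous_uncurry_flip (continuous_cost hh hL)) hu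
    (hunif.continuous (Frequently.of_forall hφ)) hunif (lam := lam) (t := h * criticalValue h L)
    fun x m hm => ?_
  simp only [← hfix]
  refine tendsto_entropyOpBack hh hL hε hε₀ hφ hunif x ?_
  rw [← isGLB_backStep_iff hh hL] at hm
  refine ⟨?_, fun b hb => ?_⟩
  · rintro _ ⟨v, rfl⟩
    have := hm.1 ⟨v, rfl⟩
    simp only at this ⊢
    linarith
  · rw [← sub_le_iff_le_add]
    refine hm.2 ?_
    rintro _ ⟨v, rfl⟩
    have := hb ⟨v, rfl⟩
    simp only at this ⊢
    linarith

end Limits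

/-! ### Uniqueness for generic Lagrangians -/

section Generic

variable {N : ℕ} {h : ℝ} {L : Torus N → Vel N → ℝ}

lemma IsGeneric.aubrySet_nonempty (hh : 0 < h) (hL : IsLagrangian L) (hgen : IsGeneric h L) :
    (aubrySet (cost h L)).Nonempty := by
  obtain ⟨μ, hμ, hsupp⟩ := hgen
  have hM : IsMather h L μ := hμ.ge rfl
  have := hM.1.1.isProbabilityMeasure
  rw [← nonWandering_eq_aubrySet hh hL fun x a => Chain.nonneg hh hL, ← hsupp]
  exact (Measure.nonempty_support (IsProbabilityMeasure.ne_zero μ)).image _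

/-- Two continuous subactions differ by a constant on the Aubry set. -/
lemma IsGeneric.const_on_aubrySet (hh : 0 < h) (hL : IsLagrangian L) (hgen : IsGeneric h L)
    {u w : Torus N → ℝ} (hu : Continuous u) (hw : Continuous w)
    (hus : ∀ x y, u x ≤ cost h L x y + u y) (hws : ∀ x y, w x ≤ cost h L x y + w y) :
    ∃ t, ∀ z ∈ aubrySet (cost h L), w z - u z = t := by
  obtain ⟨μ, hμ, hsupp⟩ := hgen
  rw [← nonWandering_eq_aubrySet hh hL fun x a => Chain.nonneg hh hL, ← hsupp]
  refine IsMather.const_of_unique hh (hμ.ge rfl) (fun ν hν => hμ.le hν) hu hw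
    (fun x v => ?_) fun x v => ?_
  · linarith [hus x (step h x v), cost_step_le hh hL x v]
  · linarith [hws x (step h x v), cost_step_le hh hL x v]

lemma IsGeneric.weakKAM_unique (hh : 0 < h) (hL : IsLagrangian L) (hgen : IsGeneric h L)
    {u w : Torus N → ℝ} (hu : IsWeakKAM (cost h L) u) (hw : IsWeakKAM (cost h L) w) :
    ∃ t, ∀ x, w x = u x + t := by
  obtain ⟨t, ht⟩ := hgen.const_on_aubrySet hh hL hu.continuous hw.continuous
    (fun x y => (hu.isGLB x).1 ⟨y, rfl⟩) fun x y => (hw.isGLB x).1 ⟨y, rfl⟩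
  exact ⟨t, hu.eq_add_of_aubrySet (continuous_cost hh hL) hw ht⟩

/-- Backward fixed points are handled through their negatives, which are forward subactions. -/
lemma IsGeneric.weakKAM_flip_unique (hh : 0 < h) (hL : IsLagrangian L) (hgen : IsGeneric h L)
    {u w : Torus N → ℝ} (hu : IsWeakKAM (flip (cost h L)) u)
    (hw : IsWeakKAM (flip (cost h L)) w) : ∃ t, ∀ x, w x = u x + t := by
  have neg_sub : ∀ {f : Torus N → ℝ}, IsWeakKAM (flip (cost h L)) f →
      ∀ x y, -f x ≤ cost h L x y + -f y := fun {f} hf x y => by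
    have h₁ : f y ≤ cost h L x y + f x := (hf.isGLB y).1 ⟨x, rfl⟩
    linarith
  obtain ⟨t, ht⟩ := hgen.const_on_aubrySet hh hL hu.continuous.neg hw.continuous.neg
    (neg_sub hu) (neg_sub hw)
  rw [← aubrySet_flip] at ht
  refine ⟨-t, hu.eq_add_of_aubrySet (continuous_uncurry_flip (continuous_cost hh hL)) hw
    fun z hz => ?_⟩
  have := ht z hz
  simp only [Pi.neg_apply] at this
  linarith

lemma IsGeneric.exists_weakKAM (hh : 0 < h) (hL : IsLagrangian L) (hgen : IsGeneric h L) :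
    (∃ u, IsWeakKAM (cost h L) u) ∧ ∃ u, IsWeakKAM (flip (cost h L)) u := by
  obtain ⟨z, hz⟩ := hgen.aubrySet_nonempty hh hL
  have hzf : z ∈ aubrySet (flip (cost h L)) := aubrySet_flip.symm ▸ hz
  have hf : ∀ x a, Chain (flip (cost h L)) x x a → 0 ≤ a := fun x a ha =>
    Chain.nonneg hh hL ha.flip
  exact ⟨⟨_, isWeakKAM_manePotential (continuous_cost hh hL) (fun x a => Chain.nonneg hh hL) hz⟩,
    ⟨_, isWeakKAM_manePotential (continuous_uncurry_flip (continuous_cost hh hL)) hf hzf⟩⟩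

/-- What the uniform limits of normalized entropy solutions satisfy. -/
lemma IsRateFunction.exists_weakKAM_pair (hh : 0 < h) (hL : IsLagrangian L)
    (hgen : IsGeneric h L) {I : Torus N → Vel N → ℝ} (hI : IsRateFunction h L I) :
    ∃ φ φb : Torus N → ℝ, IsWeakKAM (cost h L) φ ∧ IsWeakKAM (flip (cost h L)) φb ∧
      IsLeast (Set.range fun x => φb x + φ x) 0 ∧
      ∀ x v, I x v = (φb x + φ (step h x v)) / h + L x v - criticalValue h L := by
  obtain ⟨ε, φ, φb, lam, φ₀, φb₀, hε, hε₀, hsol, hφ, hφb, hI⟩ := hI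
  obtain ⟨⟨u, hu⟩, ub, hub⟩ := hgen.exists_weakKAM hh hL
  refine ⟨φ₀, φb₀,
    isWeakKAM_of_entropy hh hL hu hε hε₀ (fun n => (hsol n).continuous) hφ
      fun n => (hsol n).fixed,
    isWeakKAM_flip_of_entropyBack hh hL hub hε hε₀ (fun n => (hsol n).continuous_back) hφb
      fun n => (hsol n).fixed_back,
    isLeast_zero_of_integral_exp_eq_one (τ := fun n => ε n * h)
      (fun n => (hsol n).continuous_back.add (hsol n).continuous) (hφb.add hφ)
      (fun n => mul_pos (hε n) hh) (by simpa using hε₀.mul_const h)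
      fun n => (hsol n).normalized, hI⟩

end Generic

end DiscreteAubryMather

theorem mainTheorem7 {N : ℕ} (h : ℝ) (hh : 0 < h)
    (L : DiscreteAubryMather.Torus N → DiscreteAubryMather.Vel N → ℝ)
    (hL : DiscreteAubryMather.IsLagrangian L)
    (hgen : DiscreteAubryMather.IsGeneric h L) :
    (∃ u : DiscreteAubryMather.Torus N → ℝ,
      {w | DiscreteAubryMather.IsCalibrated h L w} = {w | ∃ c : ℝ, ∀ x, w x = u x + c}) ∧
    (∀ I I' : DiscreteAubryMather.Torus N → DiscreteAubryMather.Vel N → ℝ,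
      DiscreteAubryMather.IsRateFunction h L I →
      DiscreteAubryMather.IsRateFunction h L I' → I = I') := by
  open DiscreteAubryMather in
  refine ⟨?_, fun I I' hI hI' => ?_⟩
  · obtain ⟨⟨u, hu⟩, -⟩ := hgen.exists_weakKAM hh hL
    refine ⟨u, Set.ext fun w => ⟨fun hw => ?_, ?_⟩⟩
    · exact hgen.weakKAM_unique hh hL hu ((isCalibrated_iff hh hL w).1 hw)
    · rintro ⟨c, hc⟩
      obtain rfl : w = fun x => u x + c := funext hc
      refine (isCalibrated_iff hh hL _).2 ⟨hu.continuous.add continuous_const, fun x => ⟨?_, ?_⟩⟩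
      · rintro _ ⟨y, rfl⟩
        have := (hu.isGLB x).1 ⟨y, rfl⟩
        simp only at this ⊢
        linarith
      · intro b hb
        rw [← sub_le_iff_le_add]
        refine (hu.isGLB x).2 ?_
        rintro _ ⟨y, rfl⟩
        have := hb ⟨y, rfl⟩
        simp only at this ⊢
        linarith
  · obtain ⟨φ, φb, hφ, hφb, hmin, hI⟩ := hI.exists_weakKAM_pair hh hL hgen
    obtain ⟨φ', φb', hφ', hφb', hmin', hI'⟩ := hI'.exists_weakKAM_pair hh hL hgen
    obtain ⟨s, hs⟩ := hgen.weakKAM_unique hh hL hφ hφ'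
    obtain ⟨t, ht⟩ := hgen.weakKAM_flip_unique hh hL hφb hφb'
    -- both sums have minimum zero, so the additive constants cancel
    have hst : t + s = 0 := by
      obtain ⟨x, hx⟩ := hmin.1
      obtain ⟨y, hy⟩ := hmin'.1
      have h₁ : 0 ≤ φb y + φ y := hmin.2 ⟨y, rfl⟩
      have h₂ : 0 ≤ φb' x + φ' x := hmin'.2 ⟨x, rfl⟩
      simp only at hx hy
      rw [hs, ht] at hy h₂
      linarith
    funext x v
    rw [hI, hI', hs, ht, show φb x + t + (φ (step h x v) + s)
      = φb x + φ (step h x v) + (t + s) by ring, hst, add_zero]
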